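/- Let $J\in\mathbb N$, let $\langle\cdot,\cdot\rangle$ and $|\cdot|$ be the Euclidean inner product and norm on $\mathbb R^J$, let $n_1,\dots,n_J\in\mathbb R^J$ be linearly independent unit vectors, $\mathcal I=\{1,\dots,J\}$, and let $G=\{x\in\mathbb R^J:\langle x,n_i\rangle\ge 0,\ i\in\mathcal I\}$, with faces $F_i=\{x\in\partial G:\langle x,n_i\rangle=0\}$. For $x\in G$ put $\mathcal I(x)=\{i\in\mathcal I: x\in F_i\}$ and $\mathbb H_x=\{y:\langle y,n_i\rangle=0\ \forall i\in\mathcal I(x)\}$. Let $U\subseteq\mathbb R$ be open and, for $i\in\mathcal I$, let $d_i:U\to\mathbb R^J$ be continuously differentiable with $\langle d_i(\alpha),n_i\rangle=1$ for $\alpha\in U$; let $d(\alpha,x)$ be the convex cone generated by $\{d_i(\alpha):i\in\mathcal I(x)\}$ (equal to $\{0\}$ if $\mathcal I(x)=\emptyset$). Assume: (a) for each $\alpha\in U$ the vectors $d_1(\alpha),\dots,d_J(\alpha)$ are linearly independent; (b) for each $\alpha\in U$, $B^\alpha\subset\mathbb R^J$ is a compact, convex, symmetric set with $0$ in its interior,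 and there is $\theta(\alpha)>0$ such that for $i\in\mathcal I$ and $z\in\partial B^\alpha$ with $|\langle z,n_i\rangle|<\theta(\alpha)$, every unit vector $\nu$ with $\langle\nu,y-z\rangle\ge0$ for all $y\in B^\alpha$ satisfies $\langle\nu,d_i(\alpha)\rangle=0$; moreover $\alpha\mapsto B^\alpha$ is continuous on $U$ in the Hausdorff metric; (c) for each $\alpha\in U$ there is $\pi^\alpha:\mathbb R^J\to G$ with $\pi^\alpha(x)=x$ for $x\in G$ and $\pi^\alpha(x)-x\in d(\alpha,\pi^\alpha(x))$ for $x\notin G$. Write $\|y\|_{B^\alpha}=\min\{r\ge0:y\in rB^\alpha\}$. *Skorokhod problem.* For continuous $f:[0,\infty)\to\mathbb R^J$ with $f(0)\in G$, a pair $(h,g)$ of continuous $\mathbb R^J$-valued functions on $[0,\infty)$ solves the Skorokhod problem (SP) at $\alpha$ for $f$ if $h(0)=f(0)$ and, for all $t\ge0$, $h(t)=f(t)+g(t)$, $h(t)\in G$, and $g(t)-g(s)$ lies in the convex cone generated by $\bigcup_{u\in(s,t]}d(\alpha,h(u))$ for all $s\in[0,t)$. *Derivative problem.* Along such an $h$,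 a pair $(\phi,\eta)$ of right-continuous $\mathbb R^J$-valued functions on $[0,\infty)$ with finite left limits solves the derivative problem at $\alpha$ for $\psi$ if $\eta(0)\in\operatorname{span}d(\alpha,h(0))$ and, for all $t\ge0$, $\phi(t)=\psi(t)+\eta(t)$, $\phi(t)\in\mathbb H_{h(t)}$, and $\eta(t)-\eta(s)\in\operatorname{span}\bigcup_{u\in(s,t]}d(\alpha,h(u))$ for all $s\in[0,t)$. *Derivative projections.* For $\alpha\in U$ and $x\in\partial G$, $\mathcal L_x^\alpha y$ is the unique vector in $\mathbb H_x$ with $\mathcal L_x^\alpha y-y\in\operatorname{span}d(\alpha,x)$. For $U_0\subseteq U$ compact, call $\delta_0\in[0,1)$ a contraction coefficient for $U_0$ if $\|\mathcal L_{x_K}^\alpha\cdots\mathcal L_{x_1}^\alpha y\|_{B^\alpha}\le\delta_0\|y\|_{B^\alpha}$ for all $\alpha\in U_0$, all $y\in\mathbb R^J$ and all finite sequences $x_1,\dots,x_K\in\partial G$ with $\bigcup_k\mathcal I(x_k)=\mathcal I$. **Proposition.** For each $\alpha\in U$ there is a constant $\kappa_\Lambda(\alpha)\in[0,\infty)$ such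 that the following hold. (i) For every $\alpha\in U$: if $(h,g)$ solves the SP at $\alpha$ for some continuous $f$ with $f(0)\in G$, and $(\phi_k,\eta_k)$ solves the derivative problem at $\alpha$ along $h$ for a continuous $\psi_k$, $k=1,2$, then $\sup_{s\in[0,t]}|\phi_1(s)-\phi_2(s)|\le\kappa_\Lambda(\alpha)\sup_{s\in[0,t]}|\psi_1(s)-\psi_2(s)|$ for all $t\ge0$. (ii) Every compact $U_0\subseteq U$ has a contraction coefficient, and for every compact $U_0\subseteq U$, every contraction coefficient $\delta_0$ for $U_0$ and every $\alpha\in U_0$: if $f$ is continuous with $f(0)\in G$, $\psi:[0,\infty)\to\mathbb R^J$ is continuous, $(h,g)$ solves the SP at $\alpha$ for $f$, and $(\phi,\eta)$ solves the derivative problem at $\alpha$ along $h$ for $\psi$, then for all $0\le S<T<\infty$, $$\|\phi(T)\|_{B^\alpha}\le\delta_0^{\,1\{\bigcup_{t\in[S,T]}\mathcal I(h(t))=\mathcal I\}}\,\|\phi(S)\|_{B^\alpha}+\kappa_\Lambda(\alpha)\sup_{S\le u\le T}\|\psi(u)-\psi(S)\|_{B^\alpha},$$ where $\delta_0^0=1$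 (also if $\delta_0=0$). -/

import Mathlib

open Set Filter Topology
open scoped NNReal Pointwise

/-- The space `ℝ^J` with its Euclidean inner product and norm. -/
abbrev Euc (J : ℕ) : Type := EuclideanSpace ℝ (Fin J)

/-- The data of a family of reflection problems in a simple polyhedral cone: linearly independent
unit inward normals `n i`, an open parameter set `U ⊆ ℝ`, and reflection directions `d i α`,
continuously differentiable in `α ∈ U` and normalized by `⟨d i α, n i⟩ = 1`.
(Values of `d` at parameters outside `U` play no role.) -/
structure ReflectionData (J : ℕ) where
  n : Fin J → Euc J
  norm_n : ∀ i, ‖n i‖ = 1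
  linearIndependent_n : LinearIndependent ℝ n
  U : Set ℝ
  isOpen_U : IsOpen U
  d : Fin J → ℝ → Euc J
  contDiffOn_d : ∀ i, ContDiffOn ℝ 1 (d i) U
  inner_d_n : ∀ i, ∀ α ∈ U, inner ℝ (d i α) (n i) = 1

/-- Functions on `[0,∞)` that are right continuous and have finite left limits. -/
def IsRCLL {J : ℕ} (f : ℝ≥0 → Euc J) : Prop :=
  ∀ t, ContinuousWithinAt f (Ici t) t ∧ ∃ l, Tendsto f (𝓝[<] t) (𝓝 l)

/-- The inward unit normal vectors to `B` at `z`. -/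
def inwardNormals {J : ℕ} (B : Set (Euc J)) (z : Euc J) : Set (Euc J) :=
  {ν | ‖ν‖ = 1 ∧ ∀ y ∈ B, 0 ≤ inner ℝ ν (y - z)}

/-- The norm with unit ball `B`: the gauge of `B` at `y` is the least `r ≥ 0` with `y ∈ r B`. -/
theorem isLeast_gauge {J : ℕ} {B : Set (Euc J)} (hc : IsCompact B) (hconv : Convex ℝ B)
    (h0 : (0 : Euc J) ∈ interior B) (y : Euc J) :
    IsLeast {r : ℝ | 0 ≤ r ∧ y ∈ r • B} (gauge B y) := by
  have hmem : (0 : Euc J) ∈ B := interior_subset h0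
  have hnhds : B ∈ 𝓝 (0 : Euc J) := mem_interior_iff_mem_nhds.1 h0
  have habs : Absorbent ℝ B := absorbent_nhds_zero hnhds
  have hb : Bornology.IsVonNBounded ℝ B := hc.isVonNBounded ℝ
  refine ⟨⟨gauge_nonneg y, ?_⟩, fun r hr => gauge_le_of_mem hr.1 hr.2⟩
  rcases eq_or_ne y 0 with rfl | hy
  · rw [gauge_zero]
    exact ⟨0, hmem, by simp⟩
  · have hpos : 0 < gauge B y := (gauge_pos habs hb).2 hy
    rw [Set.mem_smul_set_iff_inv_smul_mem₀ hpos.ne']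
    refine hc.isClosed.closure_subset ?_
    rw [← gauge_le_one_iff_mem_closure hconv hnhds, gauge_smul_of_nonneg (inv_nonneg.2 hpos.le),
      smul_eq_mul, inv_mul_cancel₀ hpos.ne']

namespace ReflectionData

variable {J : ℕ} (D : ReflectionData J)

/-- The polyhedral cone `G`. -/
def G : Set (Euc J) := {x | ∀ i, 0 ≤ inner ℝ x (D.n i)}

/-- The `i`th face of `G`. -/
def face (i : Fin J) : Set (Euc J) := {x | x ∈ frontier D.G ∧ inner ℝ x (D.n i) = 0}

/-- The set `𝓘(x)` of indices of the faces containing `x`; it is empty if `x` is an interior point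
of `G`. -/
def activeSet (x : Euc J) : Set (Fin J) := {i | x ∈ D.face i}

/-- The convex cone `d(α, x)` generated by the directions of reflection active at `x`; it is `{0}`
if `x` is an interior point of `G`. -/
noncomputable def dirCone (α : ℝ) (x : Euc J) : Set (Euc J) :=
  (PointedCone.hull ℝ ((fun i => D.d i α) '' D.activeSet x) : Set (Euc J))

/-- The intersection `ℍ_x` of the hyperplanes `{y | ⟨y, n i⟩ = 0}` over the faces containing `x`; it
is all of `ℝ^J` if `x` is an interior point of `G`. -/
def hyper (x : Euc J) : Set (Euc J) := {y | ∀ i ∈ D.activeSet x, inner ℝ y (D.n i) = 0}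

/-- The directions of reflection are linearly independent at each parameter. -/
def IndependentDirections : Prop := ∀ α ∈ D.U, LinearIndependent ℝ (fun i => D.d i α)

/-- The geometric condition on a family of sets `B α`, `α ∈ U`: each is compact, convex, symmetric,
with `0` in its interior, satisfies the normal condition relative to the reflection
directions, and depends continuously on `α ∈ U` in the Hausdorff metric. -/
def SetBCondition (B : ℝ → Set (Euc J)) : Prop :=
  (∀ α ∈ D.U, IsCompact (B α) ∧ Convex ℝ (B α) ∧ (∀ x ∈ B α, -x ∈ B α) ∧ 0 ∈ interior (B α) ∧
    ∃ θ : ℝ, 0 < θ ∧ ∀ i, ∀ z ∈ frontier (B α), |inner ℝ z (D.n i)| < θ →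
      ∀ ν ∈ inwardNormals (B α) z, inner ℝ ν (D.d i α) = 0) ∧
  ∀ α₀ ∈ D.U, Tendsto (fun α => Metric.hausdorffDist (B α) (B α₀)) (𝓝[D.U] α₀) (𝓝 0)

/-- At each parameter there is a projection of `ℝ^J` onto `G` along the reflection directions. -/
def ProjectionCondition : Prop :=
  ∀ α ∈ D.U, ∃ p : Euc J → Euc J, (∀ x, p x ∈ D.G) ∧ (∀ x ∈ D.G, p x = x) ∧
    ∀ x, x ∉ D.G → p x - x ∈ D.dirCone α (p x)

/-- `(h, g)` is a solution to the Skorokhod problem with data `{(d i α, n i)}` for `f`. -/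
structure IsSPSolution (α : ℝ) (f h g : ℝ≥0 → Euc J) : Prop where
  continuous_h : Continuous h
  continuous_g : Continuous g
  initial : h 0 = f 0
  decomp : ∀ t, h t = f t + g t
  mem_G : ∀ t, h t ∈ D.G
  constraint : ∀ s t, s < t →
    g t - g s ∈ PointedCone.hull ℝ (⋃ u ∈ Ioc s t, D.dirCone α (h u))

/-- `(φ, η)` is a solution to the derivative problem along `h` for `ψ`. -/
structure IsDPSolution (α : ℝ) (h ψ φ η : ℝ≥0 → Euc J) : Prop where
  rcll_φ : IsRCLL φ
  rcll_η : IsRCLL η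
  initial : η 0 ∈ Submodule.span ℝ (D.dirCone α (h 0))
  decomp : ∀ t, φ t = ψ t + η t
  mem_hyper : ∀ t, φ t ∈ D.hyper (h t)
  constraint : ∀ s t, s < t →
    η t - η s ∈ Submodule.span ℝ (⋃ u ∈ Ioc s t, D.dirCone α (h u))

/-- `κ` is a Lipschitz constant (for the Euclidean norm) of the derivative map at the parameter `α`:
along the solution to the Skorokhod problem for any continuous path starting in `G`, solutions to
the derivative problem depend on their inputs in a Lipschitz way, with constant `κ`. -/
def IsDerivLipschitzConst (α : ℝ) (κ : ℝ≥0) : Prop :=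
  ∀ f h g : ℝ≥0 → Euc J, Continuous f → f 0 ∈ D.G → D.IsSPSolution α f h g →
  ∀ ψ₁ φ₁ η₁ ψ₂ φ₂ η₂ : ℝ≥0 → Euc J, Continuous ψ₁ → Continuous ψ₂ →
    D.IsDPSolution α h ψ₁ φ₁ η₁ → D.IsDPSolution α h ψ₂ φ₂ η₂ →
    ∀ t : ℝ≥0, ∀ s ∈ Icc 0 t,
      ‖φ₁ s - φ₂ s‖ ≤ κ * sSup ((fun u => ‖ψ₁ u - ψ₂ u‖) '' Icc 0 t)

/-- Under the geometric condition, `ℍ_x` and `span d(α, x)` meet only at `0`. -/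
theorem eq_zero_of_mem_hyper_of_mem_span {B : ℝ → Set (Euc J)} (hB : D.SetBCondition B) {α : ℝ}
    (hα : α ∈ D.U) (x v : Euc J) (hv : v ∈ D.hyper x)
    (hv' : v ∈ Submodule.span ℝ (D.dirCone α x)) : v = 0 := by
  obtain ⟨hc, hconv, -, h0, θ, hθ, hθB⟩ := hB.1 α hα
  have hnhds : B α ∈ 𝓝 (0 : Euc J) := mem_interior_iff_mem_nhds.1 h0
  by_contra hne
  have hpos : 0 < gauge (B α) v :=
    (gauge_pos (absorbent_nhds_zero hnhds) (hc.isVonNBounded ℝ)).2 hne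
  set c := (gauge (B α) v)⁻¹ with hcdef
  have hcpos : 0 < c := inv_pos.2 hpos
  have hg1 : gauge (B α) (c • v) = 1 := by
    rw [gauge_smul_of_nonneg hcpos.le, smul_eq_mul, hcdef, inv_mul_cancel₀ hpos.ne']
  have hzf : c • v ∈ frontier (B α) := (gauge_eq_one_iff_mem_frontier hconv hnhds).1 hg1
  have hznot : c • v ∉ interior (B α) := fun h => hzf.2 h
  obtain ⟨l, hl⟩ := geometric_hahn_banach_open_point hconv.interior isOpen_interior hznot
  have hl0 : 0 < l (c • v) := by simpa using hl 0 h0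
  have hle : ∀ y ∈ B α, l y ≤ l (c • v) := by
    intro y hy
    have hy' : y ∈ closure (interior (B α)) := by
      rw [hconv.closure_interior_eq_closure_of_nonempty_interior ⟨0, h0⟩]
      exact subset_closure hy
    exact closure_minimal (fun w hw => (hl w hw).le) (isClosed_le l.continuous continuous_const) hy'
  set w := (InnerProductSpace.toDual ℝ (Euc J)).symm l with hw
  have hwl : ∀ y, inner ℝ w y = l y := fun y => InnerProductSpace.toDual_symm_apply
  have hw0 : w ≠ 0 := by
    intro h
    rw [← hwl, h, inner_zero_left] at hl0
    exact hl0.false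
  have hwn : 0 < ‖w‖ := norm_pos_iff.2 hw0
  have hν : (-‖w‖⁻¹) • w ∈ inwardNormals (B α) (c • v) := by
    refine ⟨by rw [norm_smul, norm_neg, norm_inv, norm_norm, inv_mul_cancel₀ hwn.ne'], ?_⟩
    intro y hy
    have := hle y hy
    rw [real_inner_smul_left, inner_sub_right, hwl, hwl]
    nlinarith [inv_pos.2 hwn]
  have hd : ∀ i ∈ D.activeSet x, l (D.d i α) = 0 := by
    intro i hi
    have h1 := hθB i (c • v) hzf (by
      rw [real_inner_smul_left, hv i hi, mul_zero, abs_zero]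
      exact hθ) _ hν
    rw [real_inner_smul_left, hwl] at h1
    rcases mul_eq_zero.1 h1 with h | h
    · simp [hwn.ne'] at h
    · exact h
  have hcone : ∀ y ∈ D.dirCone α x, l y = 0 := by
    intro y hy
    induction hy using Submodule.span_induction with
    | mem y hy => obtain ⟨i, hi, rfl⟩ := hy; exact hd i hi
    | zero => simp
    | add a b _ _ ha hb => simp [ha, hb]
    | smul r a _ ha =>
      rw [show (r • a : Euc J) = (r : ℝ) • a from rfl, map_smul, ha, smul_zero]
  have hlv : l v = 0 := by
    have hle' : Submodule.span ℝ (D.dirCone α x) ≤ LinearMap.ker (l : Euc J →ₗ[ℝ] ℝ) :=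
      Submodule.span_le.2 fun y hy => by simpa using hcone y hy
    simpa using hle' hv'
  rw [map_smul, hlv, smul_zero] at hl0
  exact hl0.false

/-- Under the standing conditions the derivative projection exists and is unique. -/
theorem existsUnique_derivProj {B : ℝ → Set (Euc J)} (hind : D.IndependentDirections)
    (hB : D.SetBCondition B) {α : ℝ} (hα : α ∈ D.U) (x y : Euc J) :
    ∃! z, z ∈ D.hyper x ∧ z - y ∈ Submodule.span ℝ (D.dirCone α x) := by
  classical
  have hmem : ∀ i ∈ D.activeSet x, D.d i α ∈ Submodule.span ℝ (D.dirCone α x) := fun i hi =>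
    Submodule.subset_span (Submodule.subset_span ⟨i, hi, rfl⟩)
  let S : (D.activeSet x → ℝ) →ₗ[ℝ] Euc J :=
    Fintype.linearCombination ℝ (fun i : D.activeSet x => D.d i α)
  have hS : ∀ c, S c ∈ Submodule.span ℝ (D.dirCone α x) := fun c => by
    simp only [S, Fintype.linearCombination_apply]
    exact Submodule.sum_mem _ fun i _ => Submodule.smul_mem _ _ (hmem i i.2)
  let A : (D.activeSet x → ℝ) →ₗ[ℝ] (D.activeSet x → ℝ) :=
    LinearMap.pi fun i => (innerₗ (Euc J) (D.n i)).comp S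
  have hA : ∀ c i, A c i = inner ℝ (S c) (D.n i) := fun c i => by
    simp [A, real_inner_comm]
  have hAinj : Function.Injective A := by
    rw [← LinearMap.ker_eq_bot, LinearMap.ker_eq_bot']
    intro c hc
    have h0 : S c = 0 := D.eq_zero_of_mem_hyper_of_mem_span hB hα x _
      (fun i hi => by rw [← hA c ⟨i, hi⟩, hc]; rfl) (hS c)
    have hli : LinearIndependent ℝ (fun i : D.activeSet x => D.d i α) :=
      (hind α hα).comp _ Subtype.val_injective
    ext i
    exact Fintype.linearIndependent_iff.1 hli c
      (by simpa [S, Fintype.linearCombination_apply] using h0) i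
  obtain ⟨c, hc⟩ := (LinearMap.injective_iff_surjective.1 hAinj)
    (fun i => -inner ℝ y (D.n i))
  refine ⟨y + S c, ⟨fun i hi => ?_, by simpa using hS c⟩, ?_⟩
  · rw [inner_add_left, ← hA c ⟨i, hi⟩, hc]
    simp
  · rintro z ⟨hz, hz'⟩
    have h := D.eq_zero_of_mem_hyper_of_mem_span hB hα x (z - (y + S c)) (fun i hi => by
      rw [inner_sub_left, inner_add_left, hz i hi, ← hA c ⟨i, hi⟩, hc]
      simp) (by
      rw [← sub_sub]
      exact Submodule.sub_mem _ hz' (hS c))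
    exact sub_eq_zero.1 h

/-- The derivative projection operator: `derivProj α x y` is the vector `z ∈ ℍ_x` with
`z - y ∈ span d(α, x)`, which exists and is unique under the geometric condition on `B`
(see `existsUnique_derivProj`). -/
noncomputable def derivProj (α : ℝ) (x y : Euc J) : Euc J :=
  Classical.epsilon fun z => z ∈ D.hyper x ∧ z - y ∈ Submodule.span ℝ (D.dirCone α x)

/-- `δ ∈ [0,1)` is a contraction coefficient for products of derivative projection operators over
`U₀`: whenever the boundary points in the list `xs = [x₁, …, x_K]` together lie on all faces,
`‖L_{x_K} ⋯ L_{x₁} y‖ ≤ δ ‖y‖` in the norm with unit ball `B α`, for all `α ∈ U₀`. -/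
def IsContractionCoeff (B : ℝ → Set (Euc J)) (U₀ : Set ℝ) (δ : ℝ) : Prop :=
  0 ≤ δ ∧ δ < 1 ∧ ∀ α ∈ U₀, ∀ xs : List (Euc J), (∀ x ∈ xs, x ∈ frontier D.G) →
    (⋃ x ∈ xs, D.activeSet x) = univ →
    ∀ y, gauge (B α) (xs.foldl (fun z x => D.derivProj α x z) y) ≤ δ * gauge (B α) y

open Classical in
/-- The indicator that `h` visits all faces during `[S, T]`. -/
noncomputable def visitsAllFaces (h : ℝ≥0 → Euc J) (S T : ℝ≥0) : ℕ :=
  if (⋃ t ∈ Icc S T, D.activeSet (h t)) = univ then 1 else 0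

end ReflectionData

/-! Everything rests on one duality observation. Let `ν` be a norming functional of `w`, that is `ν
∈ polarBody B` with `⟨ν, w⟩ = gauge B w`. Up to sign and scale it is a normal to `B` at the radial
projection of `w`, so the geometric condition makes it vanish on `d_i` whenever `|⟨w, n_i⟩|` is
small compared with the gauge of `w`. Adding multiples of such `d_i` to `w` therefore cannot lower
its gauge (`IsMargin`).

In continuous time this becomes a maximum principle for right-continuous paths whose increments lie
in the spans of active directions (`IsMargin.gauge_le_max`). Applied to `η₁ - η₂`, whose active
normal components are minus those of `ψ₁ - ψ₂`, it gives the Lipschitz bound. Applied to the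
difference between `φ(t) - (ψ(t) - ψ(S))` and a finite product of derivative projections of `φ(S)`,
it shows that `φ` follows such a product up to an error of the size of the oscillation of `ψ`
(`IsMargin.exists_foldl_derivProj`). The points of the product cover all faces visited by `h`, so
the contraction coefficient applies when every face is visited.

A contraction coefficient exists by a quantitative form of the same duality: a functional that
almost norms the output of a product almost annihilates every direction used in it
(`eventually_almost_normal`). If all directions are used they form a basis, and a functional small
on a basis cannot almost norm a vector of gauge near one. Compactness of the parameter set makes
this uniform, and induction on the set of faces makes it independent of the length of the product.
-/

/-! ### Gauges and norming functionals -/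

/-- The one-sided polar of a set. -/
def polarBody {J : ℕ} (B : Set (Euc J)) : Set (Euc J) := {ν | ∀ y ∈ B, inner ℝ ν y ≤ 1}

theorem inner_le_gauge_of_mem_polarBody {J : ℕ} {B : Set (Euc J)} (hc : IsCompact B)
    (hconv : Convex ℝ B) (h0 : (0 : Euc J) ∈ interior B) {ν : Euc J} (hν : ν ∈ polarBody B)
    (u : Euc J) : inner ℝ ν u ≤ gauge B u := by
  obtain ⟨hg, b, hb, hu⟩ := (isLeast_gauge hc hconv h0 u).1
  calc inner ℝ ν u = gauge B u * inner ℝ ν b := by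
        conv_lhs => rw [← hu]
        exact real_inner_smul_right _ _ _
    _ ≤ gauge B u * 1 := by gcongr; exact hν b hb
    _ = gauge B u := mul_one _

theorem gauge_pos_of_ne_zero {J : ℕ} {B : Set (Euc J)} (hc : IsCompact B)
    (h0 : (0 : Euc J) ∈ interior B) {v : Euc J} (hv : v ≠ 0) : 0 < gauge B v :=
  (gauge_pos (absorbent_nhds_zero (mem_interior_iff_mem_nhds.1 h0)) (hc.isVonNBounded ℝ)).2 hv

/-- A supporting functional of `B` at the radial projection of `v`, rescaled to have maximum one
over `B`. -/
theorem exists_mem_polarBody_inner_eq_gauge {J : ℕ} {B : Set (Euc J)} (hc : IsCompact B)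
    (hconv : Convex ℝ B) (h0 : (0 : Euc J) ∈ interior B) (v : Euc J) :
    ∃ ν ∈ polarBody B, inner ℝ ν v = gauge B v := by
  have hnhds : B ∈ 𝓝 (0 : Euc J) := mem_interior_iff_mem_nhds.1 h0
  rcases eq_or_ne v 0 with rfl | hne
  · exact ⟨0, fun y _ => by simp, by simp⟩
  have hpos := gauge_pos_of_ne_zero hc h0 hne
  set c := (gauge B v)⁻¹ with hcdef
  have hcpos : 0 < c := inv_pos.2 hpos
  have hg1 : gauge B (c • v) = 1 := by
    rw [gauge_smul_of_nonneg hcpos.le, smul_eq_mul, hcdef, inv_mul_cancel₀ hpos.ne']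
  have hznot : c • v ∉ interior B := fun h =>
    ((gauge_eq_one_iff_mem_frontier hconv hnhds).1 hg1).2 h
  obtain ⟨l, hl⟩ := geometric_hahn_banach_open_point hconv.interior isOpen_interior hznot
  have hl0 : 0 < l (c • v) := by simpa using hl 0 h0
  have hle : ∀ y ∈ B, l y ≤ l (c • v) := by
    intro y hy
    have hy' : y ∈ closure (interior B) := by
      rw [hconv.closure_interior_eq_closure_of_nonempty_interior ⟨0, h0⟩]
      exact subset_closure hy
    exact closure_minimal (fun w hw => (hl w hw).le) (isClosed_le l.continuous continuous_const) hy'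
  have hwl : ∀ y, inner ℝ ((InnerProductSpace.toDual ℝ (Euc J)).symm l) y = l y :=
    fun y => InnerProductSpace.toDual_symm_apply
  refine ⟨(l (c • v))⁻¹ • (InnerProductSpace.toDual ℝ (Euc J)).symm l, fun y hy => ?_, ?_⟩
  · rw [real_inner_smul_left, hwl, inv_mul_le_iff₀ hl0, mul_one]
    exact hle y hy
  · have h1 : l (c • v) = c * l v := by simp
    have h2 : l v ≠ 0 := fun h => by simp [h1, h] at hl0
    rw [real_inner_smul_left, hwl, h1, mul_inv, mul_assoc, inv_mul_cancel₀ h2, mul_one, hcdef,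
      inv_inv]

/-- A functional in the polar attaining its bound at `w` is, up to sign and scaling, an inward normal
at the radial projection of `w` to the boundary. -/
theorem inner_eq_zero_of_normal {J : ℕ} {B : Set (Euc J)}
    (hconv : Convex ℝ B) (h0 : (0 : Euc J) ∈ interior B) {θ : ℝ} {m e : Euc J}
    (hθ : ∀ z ∈ frontier B, |inner ℝ z m| < θ → ∀ ν ∈ inwardNormals B z, inner ℝ ν e = 0)
    {ν w : Euc J} (hν : ν ∈ polarBody B) (hw : inner ℝ ν w = gauge B w) (hpos : 0 < gauge B w)
    (hm : |inner ℝ w m| < gauge B w * θ) : inner ℝ ν e = 0 := by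
  have hnhds : B ∈ 𝓝 (0 : Euc J) := mem_interior_iff_mem_nhds.1 h0
  set c := (gauge B w)⁻¹ with hcdef
  have hcpos : 0 < c := inv_pos.2 hpos
  have hg1 : gauge B (c • w) = 1 := by
    rw [gauge_smul_of_nonneg hcpos.le, smul_eq_mul, hcdef, inv_mul_cancel₀ hpos.ne']
  have hzf : c • w ∈ frontier B := (gauge_eq_one_iff_mem_frontier hconv hnhds).1 hg1
  have hν0 : ν ≠ 0 := fun h => by rw [h, inner_zero_left] at hw; exact hpos.ne hw
  have hνn : 0 < ‖ν‖ := norm_pos_iff.2 hν0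
  have hν1 : inner ℝ ν (c • w) = 1 := by
    rw [real_inner_smul_right, hw, hcdef, inv_mul_cancel₀ hpos.ne']
  have key := hθ (c • w) hzf (by
    rw [real_inner_smul_left, abs_mul, abs_of_pos hcpos, hcdef, inv_mul_lt_iff₀ hpos]
    exact hm) ((-‖ν‖⁻¹) • ν) ⟨by
      rw [norm_smul, norm_neg, norm_inv, norm_norm, inv_mul_cancel₀ hνn.ne'], fun y hy => by
      rw [real_inner_smul_left, inner_sub_right, hν1]
      have := hν y hy
      nlinarith [inv_pos.2 hνn]⟩
  rw [real_inner_smul_left] at key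
  rcases mul_eq_zero.1 key with h | h
  · simp [hνn.ne'] at h
  · exact h

theorem exists_norm_le_mul_gauge {J : ℕ} {B : Set (Euc J)} (hc : IsCompact B)
    (hconv : Convex ℝ B) (h0 : (0 : Euc J) ∈ interior B) :
    ∃ R : ℝ, 0 < R ∧ ∀ y, ‖y‖ ≤ R * gauge B y := by
  obtain ⟨R, hR, hBR⟩ := hc.isBounded.exists_pos_norm_le
  refine ⟨R, hR, fun y => ?_⟩
  obtain ⟨hg, b, hb, hu⟩ := (isLeast_gauge hc hconv h0 y).1
  calc ‖y‖ = gauge B y * ‖b‖ := by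
        conv_lhs => rw [← hu]
        change ‖gauge B y • b‖ = _
        rw [norm_smul, Real.norm_of_nonneg hg]
    _ ≤ gauge B y * R := by gcongr; exact hBR b hb
    _ = R * gauge B y := mul_comm _ _

/-! ### The margin inequality -/

namespace ReflectionData

variable {J : ℕ} (D : ReflectionData J)

/-- The span of the directions of reflection with index in `A`. -/
def dirSpan (α : ℝ) (A : Set (Fin J)) : Submodule ℝ (Euc J) :=
  Submodule.span ℝ ((fun i => D.d i α) '' A)

theorem dirSpan_mono (α : ℝ) {A A' : Set (Fin J)} (h : A ⊆ A') : D.dirSpan α A ≤ D.dirSpan α A' :=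
  Submodule.span_mono (image_mono h)

theorem dirCone_subset_dirSpan (α : ℝ) (x : Euc J) :
    D.dirCone α x ⊆ D.dirSpan α (D.activeSet x) := by
  intro y hy
  induction hy using Submodule.span_induction with
  | mem y hy => exact Submodule.subset_span hy
  | zero => exact Submodule.zero_mem _
  | add a b _ _ ha hb => exact Submodule.add_mem _ ha hb
  | smul r a _ ha => exact Submodule.smul_mem _ (r : ℝ) ha

theorem span_dirCone (α : ℝ) (x : Euc J) :
    Submodule.span ℝ (D.dirCone α x) = D.dirSpan α (D.activeSet x) :=
  le_antisymm (Submodule.span_le.2 (D.dirCone_subset_dirSpan α x))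
    (Submodule.span_mono Submodule.subset_span)

theorem span_iUnion_dirCone_le (α : ℝ) {h : ℝ≥0 → Euc J} {I : Set ℝ≥0} {A : Set (Fin J)}
    (hI : ∀ u ∈ I, D.activeSet (h u) ⊆ A) :
    Submodule.span ℝ (⋃ u ∈ I, D.dirCone α (h u)) ≤ D.dirSpan α A :=
  Submodule.span_le.2 (iUnion₂_subset fun u hu =>
    (D.dirCone_subset_dirSpan α (h u)).trans (D.dirSpan_mono α (hI u hu)))

theorem inner_eq_zero_of_mem_dirSpan {α : ℝ} {A : Set (Fin J)} {ν v : Euc J}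
    (hν : ∀ i ∈ A, inner ℝ ν (D.d i α) = 0) (hv : v ∈ D.dirSpan α A) : inner ℝ ν v = 0 := by
  induction hv using Submodule.span_induction with
  | mem y hy => obtain ⟨i, hi, rfl⟩ := hy; exact hν i hi
  | zero => simp
  | add a b _ _ ha hb => rw [inner_add_right, ha, hb, add_zero]
  | smul r a _ ha => rw [real_inner_smul_right, ha, mul_zero]

/-- `θ` is a margin at `α`: moving a vector `w` along directions of reflection with index in `A` does
not decrease its gauge by much if `w` is close to the hyperplanes with index in `A`. -/
def IsMargin (B : ℝ → Set (Euc J)) (α θ : ℝ) : Prop :=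
  0 < θ ∧ ∀ (A : Set (Fin J)) (w w' : Euc J) (C : ℝ), 0 ≤ C →
    (∀ i ∈ A, |inner ℝ w (D.n i)| ≤ C * θ) → w' - w ∈ D.dirSpan α A →
    gauge (B α) w ≤ max (gauge (B α) w') C

variable {D} {B : ℝ → Set (Euc J)}

/-- If the gauge of `w` exceeds `C`, its norming functional kills every `d_i` with `i ∈ A`, hence
takes the same value at `w` and `w'`. -/
theorem SetBCondition.exists_isMargin (hB : D.SetBCondition B) {α : ℝ} (hα : α ∈ D.U) :
    ∃ θ, D.IsMargin B α θ := by
  obtain ⟨hc, hconv, -, h0, θ, hθ, hθB⟩ := hB.1 α hα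
  refine ⟨θ, hθ, fun A w w' C hC hA hw => ?_⟩
  rcases le_or_gt (gauge (B α) w) C with hle | hlt
  · exact hle.trans (le_max_right _ _)
  refine le_max_of_le_left ?_
  obtain ⟨ν, hν, hνw⟩ := exists_mem_polarBody_inner_eq_gauge hc hconv h0 w
  have hd : ∀ i ∈ A, inner ℝ ν (D.d i α) = 0 := fun i hi =>
    inner_eq_zero_of_normal hconv h0 (hθB i) hν hνw (hC.trans_lt hlt)
      ((hA i hi).trans_lt (by gcongr))
  have h1 := D.inner_eq_zero_of_mem_dirSpan hd hw
  rw [inner_sub_right, sub_eq_zero] at h1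
  rw [← hνw, ← h1]
  exact inner_le_gauge_of_mem_polarBody hc hconv h0 hν w'

end ReflectionData

/-! ### Active faces and derivative projections -/

namespace ReflectionData

variable {J : ℕ} (D : ReflectionData J)

theorem mem_activeSet_iff {x : Euc J} (hx : x ∈ D.G) (i : Fin J) :
    i ∈ D.activeSet x ↔ inner ℝ x (D.n i) = 0 := by
  refine ⟨fun h => h.2, fun h => ⟨⟨subset_closure hx, fun hint => ?_⟩, h⟩⟩
  -- Moving from `x` along `-n_i` leaves `G` at once, so `x` is not interior.
  have hcont : Tendsto (fun r : ℝ => x - r • D.n i) (𝓝[>] 0) (𝓝 x) := by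
    have : Continuous fun r : ℝ => x - r • D.n i := by fun_prop
    simpa using (this.tendsto 0).mono_left nhdsWithin_le_nhds
  have hev : ∀ᶠ r in 𝓝[>] (0 : ℝ), x - r • D.n i ∈ D.G :=
    hcont.eventually (mem_interior_iff_mem_nhds.1 hint)
  obtain ⟨r, hr, hr0⟩ := (hev.and self_mem_nhdsWithin).exists
  have h1 := hr i
  rw [inner_sub_left, h, real_inner_smul_left, real_inner_self_eq_norm_sq, D.norm_n] at h1
  have : (0 : ℝ) < r := hr0
  linarith

/-- Inactivity of a face is an open condition and there are finitely many faces. -/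
theorem eventually_activeSet_subset {h : ℝ≥0 → Euc J} (hh : Continuous h)
    (hG : ∀ t, h t ∈ D.G) (t : ℝ≥0) : ∀ᶠ u in 𝓝 t, D.activeSet (h u) ⊆ D.activeSet (h t) := by
  have key : ∀ i, ∀ᶠ u in 𝓝 t, i ∈ D.activeSet (h u) → i ∈ D.activeSet (h t) := by
    intro i
    by_cases hi : i ∈ D.activeSet (h t)
    · exact Eventually.of_forall fun _ _ => hi
    · have hne : inner ℝ (h t) (D.n i) ≠ 0 := fun h0 => hi ((D.mem_activeSet_iff (hG t) i).2 h0)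
      have hc : Continuous fun u => (inner ℝ (h u) (D.n i) : ℝ) := by fun_prop
      filter_upwards [hc.continuousAt.eventually_ne hne] with u hu hu'
      exact absurd ((D.mem_activeSet_iff (hG u) i).1 hu') hu
  filter_upwards [eventually_all.2 key] with u hu i hi using hu i hi

variable {D} {B : ℝ → Set (Euc J)} (hind : D.IndependentDirections) (hB : D.SetBCondition B)
  {α : ℝ} (hα : α ∈ D.U)
include hind hB hα

theorem derivProj_spec (x y : Euc J) : D.derivProj α x y ∈ D.hyper x ∧
    D.derivProj α x y - y ∈ D.dirSpan α (D.activeSet x) := by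
  rw [← span_dirCone]
  exact Classical.epsilon_spec (D.existsUnique_derivProj hind hB hα x y).exists

theorem derivProj_eq {x y z : Euc J} (hz : z ∈ D.hyper x)
    (hz' : z - y ∈ D.dirSpan α (D.activeSet x)) : D.derivProj α x y = z :=
  (D.existsUnique_derivProj hind hB hα x y).unique
    (by rw [span_dirCone]; exact derivProj_spec hind hB hα x y)
    ⟨hz, by rwa [span_dirCone]⟩

theorem derivProj_smul (x y : Euc J) (c : ℝ) :
    D.derivProj α x (c • y) = c • D.derivProj α x y := by
  obtain ⟨h1, h2⟩ := derivProj_spec hind hB hα x y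
  refine derivProj_eq hind hB hα (fun i hi => ?_) ?_
  · rw [real_inner_smul_left, h1 i hi, mul_zero]
  · rw [← smul_sub]
    exact Submodule.smul_mem _ _ h2

/-- This is the margin inequality with `C = 0`, since the projected vector lies exactly in the
active hyperplanes. -/
theorem gauge_derivProj_le (x y : Euc J) : gauge (B α) (D.derivProj α x y) ≤ gauge (B α) y := by
  obtain ⟨h1, h2⟩ := derivProj_spec hind hB hα x y
  obtain ⟨θ, hθ, hm⟩ := hB.exists_isMargin hα
  have := hm (D.activeSet x) (D.derivProj α x y) y 0 le_rfl
    (fun i hi => by rw [h1 i hi]; simp) (by rw [← neg_sub]; exact Submodule.neg_mem _ h2)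
  simpa [gauge_nonneg] using this

theorem foldl_derivProj_smul (xs : List (Euc J)) (y : Euc J) (c : ℝ) :
    xs.foldl (fun z x => D.derivProj α x z) (c • y) =
      c • xs.foldl (fun z x => D.derivProj α x z) y := by
  induction xs generalizing y with
  | nil => rfl
  | cons x xs ih => rw [List.foldl_cons, List.foldl_cons, derivProj_smul hind hB hα, ih]

theorem gauge_foldl_derivProj_le (xs : List (Euc J)) (y : Euc J) :
    gauge (B α) (xs.foldl (fun z x => D.derivProj α x z) y) ≤ gauge (B α) y := by
  induction xs generalizing y with
  | nil => exact le_rfl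
  | cons x xs ih => exact (ih _).trans (gauge_derivProj_le hind hB hα x y)

theorem foldl_derivProj_sub_mem (xs : List (Euc J)) (y : Euc J) :
    xs.foldl (fun z x => D.derivProj α x z) y - y ∈
      D.dirSpan α (⋃ x ∈ xs, D.activeSet x) := by
  induction xs generalizing y with
  | nil => simp
  | cons x xs ih =>
    rw [List.foldl_cons, ← sub_add_sub_cancel _ (D.derivProj α x y) y]
    refine Submodule.add_mem _ (D.dirSpan_mono α ?_ (ih _))
      (D.dirSpan_mono α ?_ (derivProj_spec hind hB hα x y).2)
    · exact biUnion_subset_biUnion_left fun z hz => List.mem_cons_of_mem _ hz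
    · exact subset_biUnion_of_mem (u := D.activeSet) (List.mem_cons_self (a := x))

end ReflectionData

/-! ### Maximum principle, Lipschitz bound and comparison with products of projections -/

namespace ReflectionData

variable {J : ℕ} {D : ReflectionData J} {B : ℝ → Set (Euc J)}

theorem SetBCondition.continuous_gauge (hB : D.SetBCondition B) {α : ℝ} (hα : α ∈ D.U) :
    Continuous (gauge (B α)) := by
  obtain ⟨-, hconv, -, h0, -⟩ := hB.1 α hα
  exact _root_.continuous_gauge hconv (mem_interior_iff_mem_nhds.1 h0)

/-- Otherwise follow the gauge backwards from `b` as long as it stays at or above its final value.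
Right continuity retains the bound at the infimum `τ` of such times. Just before `τ` only faces
active at `τ` are met, so the margin inequality carries the bound, even across a jump, to the left
of `τ`. -/
theorem IsMargin.gauge_le_max {α θ : ℝ} (hθ : D.IsMargin B α θ)
    (hgc : Continuous (gauge (B α))) {h w : ℝ≥0 → Euc J} (hh : Continuous h)
    (hG : ∀ t, h t ∈ D.G) (hw : ∀ t, ContinuousWithinAt w (Ici t) t) {a b : ℝ≥0} (hab : a ≤ b)
    {C : ℝ} (hC : 0 ≤ C)
    (hinc : ∀ s t, s < t → w t - w s ∈ Submodule.span ℝ (⋃ u ∈ Ioc s t, D.dirCone α (h u)))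
    (hn : ∀ t, a < t → t ≤ b → ∀ i ∈ D.activeSet (h t), |inner ℝ (w t) (D.n i)| ≤ C * θ) :
    gauge (B α) (w b) ≤ max (gauge (B α) (w a)) C := by
  by_contra! hlt
  obtain ⟨hga, hgC⟩ := max_lt_iff.1 hlt
  set g := gauge (B α) (w b) with hg
  set S : Set ℝ≥0 := {s | a ≤ s ∧ s ≤ b ∧ ∀ r, s ≤ r → r ≤ b → g ≤ gauge (B α) (w r)} with hS
  have hbS : b ∈ S := ⟨hab, le_rfl, fun r h1 h2 => by rw [le_antisymm h2 h1]⟩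
  set τ := sInf S with hτ
  have hτb : τ ≤ b := csInf_le (OrderBot.bddBelow S) hbS
  have haτ : a ≤ τ := le_csInf ⟨b, hbS⟩ fun s hs => hs.1
  have hright : ∀ r, τ < r → r ≤ b → g ≤ gauge (B α) (w r) := fun r h1 h2 => by
    obtain ⟨s, hs, hsr⟩ := exists_lt_of_csInf_lt ⟨b, hbS⟩ h1
    exact hs.2.2 r hsr.le h2
  have hgτ : g ≤ gauge (B α) (w τ) := by
    rcases hτb.eq_or_lt with h | h
    · rw [h]
    · have h1 : Tendsto (fun r => gauge (B α) (w r)) (𝓝[>] τ) (𝓝 (gauge (B α) (w τ))) :=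
        (hgc.tendsto _).comp ((hw τ).mono_left (nhdsWithin_mono _ Ioi_subset_Ici_self))
      have : (𝓝[>] τ).NeBot := nhdsGT_neBot_of_exists_gt ⟨b, h⟩
      refine ge_of_tendsto h1 ?_
      filter_upwards [Ioc_mem_nhdsGT h] with r hr using hright r hr.1 hr.2
  rcases haτ.eq_or_lt with h | h
  · rw [h] at hga
    exact hga.not_ge hgτ
  · obtain ⟨l, hl, hlsub⟩ := exists_Ioc_subset_of_mem_nhds
      (D.eventually_activeSet_subset hh hG τ) ⟨a, h⟩
    obtain ⟨s, hs, hsτ⟩ := exists_between (max_lt hl h)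
    obtain ⟨hls, has⟩ := max_lt_iff.1 hs
    have hsS : s ∈ S := by
      refine ⟨has.le, hsτ.le.trans hτb, fun r hsr hrb => ?_⟩
      rcases lt_trichotomy r τ with hr | hr | hr
      · have hm := hθ.2 _ (w τ) (w r) C hC (hn τ h hτb) (by
          rw [← neg_sub]
          exact Submodule.neg_mem _ (span_iUnion_dirCone_le D α
            (fun u hu => hlsub ⟨(hls.trans_le hsr).trans hu.1, hu.2⟩) (hinc r τ hr)))
        rcases le_max_iff.1 (hgτ.trans hm) with h1 | h1
        · exact h1
        · exact absurd h1 hgC.not_ge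
      · rw [hr]; exact hgτ
      · exact hright r hr hrb
    exact (csInf_le (OrderBot.bddBelow S) hsS).not_gt hsτ

theorem exists_derivLipschitzConst (hB : D.SetBCondition B) {α : ℝ} (hα : α ∈ D.U) :
    ∃ κ : ℝ≥0, ∀ κ', κ ≤ κ' → D.IsDerivLipschitzConst α κ' := by
  obtain ⟨θ, hθ⟩ := hB.exists_isMargin hα
  have hθ0 := hθ.1
  obtain ⟨hc, hconv, -, h0, -⟩ := hB.1 α hα
  obtain ⟨R, hR, hRle⟩ := exists_norm_le_mul_gauge hc hconv h0
  refine ⟨⟨1 + R / θ, by positivity⟩, fun κ' hκ' => ?_⟩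
  intro f h g _ _ hsp ψ₁ φ₁ η₁ ψ₂ φ₂ η₂ hψ₁ hψ₂ h₁ h₂ t s hs
  set M := sSup ((fun u => ‖ψ₁ u - ψ₂ u‖) '' Icc 0 t) with hM
  have hle : ∀ u ∈ Icc 0 t, ‖ψ₁ u - ψ₂ u‖ ≤ M := fun u hu =>
    le_csSup ((isCompact_Icc.image (by fun_prop)).bddAbove) (mem_image_of_mem _ hu)
  have hM0 : 0 ≤ M := (norm_nonneg _).trans (hle s hs)
  have hin : ∀ u ∈ Icc 0 t, ∀ i ∈ D.activeSet (h u),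
      |inner ℝ (η₁ u - η₂ u) (D.n i)| ≤ M / θ * θ := by
    intro u hu i hi
    have e : η₁ u - η₂ u = (φ₁ u - φ₂ u) - (ψ₁ u - ψ₂ u) := by
      rw [h₁.decomp, h₂.decomp]; abel
    have e2 : inner ℝ (φ₁ u - φ₂ u) (D.n i) = 0 := by
      rw [inner_sub_left, h₁.mem_hyper u i hi, h₂.mem_hyper u i hi, sub_zero]
    rw [e, inner_sub_left, e2, zero_sub, abs_neg, div_mul_cancel₀ _ hθ0.ne']
    refine (abs_real_inner_le_norm _ _).trans ?_
    rw [D.norm_n, mul_one]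
    exact hle u hu
  have hg0 : gauge (B α) (η₁ 0 - η₂ 0) ≤ M / θ := by
    -- The initial condition on `η` allows comparison with the zero vector, as if the path jumped
    -- from `0` at time zero.
    have := hθ.2 _ (η₁ 0 - η₂ 0) 0 (M / θ) (by positivity)
      (hin 0 ⟨le_rfl, hs.1.trans hs.2⟩) (by
        rw [← span_dirCone, zero_sub]
        exact Submodule.neg_mem _ (Submodule.sub_mem _ h₁.initial h₂.initial))
    rwa [gauge_zero, max_eq_right (by positivity)] at this
  have hgs := hθ.gauge_le_max (hB.continuous_gauge hα) hsp.continuous_h hsp.mem_G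
    (w := fun u => η₁ u - η₂ u) (fun u => (h₁.rcll_η u).1.sub (h₂.rcll_η u).1) hs.1
    (C := M / θ) (by positivity) (fun r u hru => by
      rw [sub_sub_sub_comm]
      exact Submodule.sub_mem _ (h₁.constraint r u hru) (h₂.constraint r u hru))
    (fun u _ hus => hin u ⟨zero_le, hus.trans hs.2⟩)
  replace hgs := hgs.trans (max_le hg0 le_rfl)
  have hκ : (1 + R / θ : ℝ) ≤ κ' := hκ'
  calc ‖φ₁ s - φ₂ s‖ = ‖(ψ₁ s - ψ₂ s) + (η₁ s - η₂ s)‖ := by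
        rw [h₁.decomp, h₂.decomp]; congr 1; abel
    _ ≤ M + R * (M / θ) := (norm_add_le _ _).trans
        (add_le_add (hle s hs) ((hRle _).trans (by gcongr)))
    _ = (1 + R / θ) * M := by ring
    _ ≤ κ' * M := by gcongr

/-- Continuous induction on the time reached. The path `φ(t) - (ψ(t) - ψ(S))` has the increments of
`η`. Arriving at `t` from the left, one more projection at `h t` is appended; leaving `t` to the
right, no new face is met for a while and the list is kept. -/
theorem IsMargin.exists_foldl_derivProj (hind : D.IndependentDirections)
    (hB : D.SetBCondition B) {α θ : ℝ} (hα : α ∈ D.U) (hθ : D.IsMargin B α θ)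
    {h ψ φ η : ℝ≥0 → Euc J} (hh : Continuous h) (hG : ∀ t, h t ∈ D.G) (hψ : Continuous ψ)
    (hdp : D.IsDPSolution α h ψ φ η) {S T : ℝ≥0} (hST : S ≤ T) {C : ℝ} (hC : 0 ≤ C)
    (hψC : ∀ u ∈ Icc S T, ‖ψ u - ψ S‖ ≤ C * θ) :
    ∃ xs : List (Euc J), (∀ x ∈ xs, x ∈ frontier D.G) ∧
      (⋃ u ∈ Icc S T, D.activeSet (h u)) ⊆ (⋃ x ∈ xs, D.activeSet x) ∧
      gauge (B α) (φ T - (ψ T - ψ S) - xs.foldl (fun z x => D.derivProj α x z) (φ S)) ≤ C := by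
  -- An interior point may not enter the list, but its projection is the identity, so the list is
  -- then left unchanged.
  have hsnoc : ∀ (xs : List (Euc J)) (t : ℝ≥0), (∀ x ∈ xs, x ∈ frontier D.G) →
      ∃ ys : List (Euc J), (∀ x ∈ ys, x ∈ frontier D.G) ∧
        (⋃ x ∈ xs, D.activeSet x) ∪ D.activeSet (h t) ⊆ (⋃ x ∈ ys, D.activeSet x) ∧
        ∀ y, ys.foldl (fun z x => D.derivProj α x z) y =
          D.derivProj α (h t) (xs.foldl (fun z x => D.derivProj α x z) y) := by
    intro xs t hxs
    by_cases ht : h t ∈ frontier D.G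
    · refine ⟨xs ++ [h t], fun x hx => ?_, ?_, fun y => by simp [List.foldl_append]⟩
      · rcases List.mem_append.1 hx with hx | hx
        · exact hxs x hx
        · rw [List.mem_singleton.1 hx]; exact ht
      · refine union_subset (biUnion_subset_biUnion_left fun x hx => List.mem_append_left _ hx) ?_
        exact subset_biUnion_of_mem (u := D.activeSet) (List.mem_append_right xs (by simp))
    · have hempty : D.activeSet (h t) = ∅ := eq_empty_of_forall_notMem fun i hi => ht hi.1
      refine ⟨xs, hxs, by rw [hempty, union_empty], fun y => ?_⟩
      refine (derivProj_eq hind hB hα (fun i hi => ?_) (by simp)).symm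
      rw [hempty] at hi
      exact hi.elim
  -- Membership of the product in the hyperplanes at `h t` strengthens the induction: it controls
  -- the normal components of the difference when moving right.
  set P : ℝ≥0 → Prop := fun t => ∃ xs : List (Euc J), (∀ x ∈ xs, x ∈ frontier D.G) ∧
      (⋃ u ∈ Icc S t, D.activeSet (h u)) ⊆ (⋃ x ∈ xs, D.activeSet x) ∧
      xs.foldl (fun z x => D.derivProj α x z) (φ S) ∈ D.hyper (h t) ∧
      gauge (B α) (φ t - (ψ t - ψ S) - xs.foldl (fun z x => D.derivProj α x z) (φ S)) ≤ C with hP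
  have hφη : ∀ s t, (φ t - (ψ t - ψ S)) - (φ s - (ψ s - ψ S)) = η t - η s := fun s t => by
    rw [hdp.decomp t, hdp.decomp s]; abel
  have hin : ∀ t ∈ Icc S T, ∀ y ∈ D.hyper (h t), ∀ i ∈ D.activeSet (h t),
      |inner ℝ (φ t - (ψ t - ψ S) - y) (D.n i)| ≤ C * θ := by
    intro t ht y hy i hi
    rw [inner_sub_left, inner_sub_left, hdp.mem_hyper t i hi, hy i hi, sub_zero, zero_sub, abs_neg]
    refine (abs_real_inner_le_norm _ _).trans ?_
    rw [D.norm_n, mul_one]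
    exact hψC t ht
  have hPS : P S := by
    obtain ⟨xs, h1, h2, h3⟩ := hsnoc [] S (by simp)
    have h4 : D.derivProj α (h S) (φ S) = φ S :=
      derivProj_eq hind hB hα (hdp.mem_hyper S) (by simp)
    refine ⟨xs, h1, by simpa using h2, ?_, ?_⟩
    · rw [h3, List.foldl_nil, h4]; exact hdp.mem_hyper S
    · rw [h3, List.foldl_nil, h4]; simpa using hC
  have hleft : ∀ s t, S ≤ s → s < t → t ≤ T →
      (∀ u ∈ Ioc s t, D.activeSet (h u) ⊆ D.activeSet (h t)) → P s → P t := by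
    rintro s t hSs hst htT hsub ⟨xs, h1, h2, h3, h4⟩
    obtain ⟨ys, h1', h2', h3'⟩ := hsnoc xs t h1
    obtain ⟨hL1, hL2⟩ := derivProj_spec hind hB hα (h t)
      (xs.foldl (fun z x => D.derivProj α x z) (φ S))
    refine ⟨ys, h1', ?_, by rw [h3']; exact hL1, ?_⟩
    · refine iUnion₂_subset fun u hu => ?_
      rcases le_or_gt u s with hus | hus
      · exact (subset_biUnion_of_mem (u := fun u => D.activeSet (h u))
          (show u ∈ Icc S s from ⟨hu.1, hus⟩)).trans (h2.trans (subset_union_left.trans h2'))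
      · exact (hsub u ⟨hus, hu.2⟩).trans (subset_union_right.trans h2')
    · have hm := hθ.2 _ _ (φ s - (ψ s - ψ S) - xs.foldl (fun z x => D.derivProj α x z) (φ S)) C hC
        (hin t ⟨hSs.trans hst.le, htT⟩ _ hL1) (by
          rw [← neg_sub, sub_sub_sub_comm, hφη]
          exact Submodule.neg_mem _ (Submodule.sub_mem _
            (span_iUnion_dirCone_le D α hsub (hdp.constraint s t hst)) hL2))
      rw [h3']
      exact hm.trans (max_le h4 le_rfl)
  have hrightP : ∀ t r, S ≤ t → t ≤ r → r ≤ T →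
      (∀ u ∈ Icc t r, D.activeSet (h u) ⊆ D.activeSet (h t)) → P t → P r := by
    rintro t r hSt htr hrT hsub ⟨xs, h1, h2, h3, h4⟩
    have h3' : ∀ u ∈ Icc t r,
        xs.foldl (fun z x => D.derivProj α x z) (φ S) ∈ D.hyper (h u) :=
      fun u hu i hi => h3 i (hsub u hu hi)
    refine ⟨xs, h1, ?_, h3' r ⟨htr, le_rfl⟩, ?_⟩
    · refine iUnion₂_subset fun u hu => ?_
      rcases le_or_gt u t with hut | hut
      · exact (subset_biUnion_of_mem (u := fun u => D.activeSet (h u))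
          (show u ∈ Icc S t from ⟨hu.1, hut⟩)).trans h2
      · exact (hsub u ⟨hut.le, hu.2⟩).trans ((subset_biUnion_of_mem
          (u := fun u => D.activeSet (h u)) (show t ∈ Icc S t from ⟨hSt, le_rfl⟩)).trans h2)
    · have := hθ.gauge_le_max (hB.continuous_gauge hα) hh hG
        (w := fun u => φ u - (ψ u - ψ S) - xs.foldl (fun z x => D.derivProj α x z) (φ S))
        (fun u => ((hdp.rcll_φ u).1.sub
          (hψ.sub continuous_const).continuousWithinAt).sub continuousWithinAt_const) htr hC
        (fun s u hsu => by
          rw [sub_sub_sub_cancel_right, hφη]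
          exact hdp.constraint s u hsu)
        (fun u htu hur => hin u ⟨hSt.trans htu.le, hur.trans hrT⟩ _ (h3' u ⟨htu.le, hur⟩))
      exact this.trans (max_le h4 le_rfl)
  set A : Set ℝ≥0 := {t | S ≤ t ∧ t ≤ T ∧ P t} with hA
  have hSA : S ∈ A := ⟨le_rfl, hST, hPS⟩
  have hbdd : BddAbove A := ⟨T, fun t ht => ht.2.1⟩
  set τ := sSup A with hτ
  have hSτ : S ≤ τ := le_csSup hbdd hSA
  have hτT : τ ≤ T := csSup_le ⟨S, hSA⟩ fun t ht => ht.2.1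
  have hev := D.eventually_activeSet_subset hh hG τ
  have hPτ : P τ := by
    rcases hSτ.eq_or_lt with h | h
    · rw [← h]; exact hPS
    · obtain ⟨l, hl, hlsub⟩ := exists_Ioc_subset_of_mem_nhds hev ⟨S, h⟩
      obtain ⟨s, hs, hls⟩ := exists_lt_of_lt_csSup ⟨S, hSA⟩ hl
      rcases (le_csSup hbdd hs).eq_or_lt with h' | h'
      · rw [hτ, ← h']; exact hs.2.2
      · exact hleft s τ hs.1 h' hτT (fun u hu => hlsub ⟨hls.trans hu.1, hu.2⟩) hs.2.2
  have hτT' : τ = T := by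
    refine hτT.eq_of_not_lt fun h => ?_
    obtain ⟨l, hl, hlsub⟩ := exists_Ico_subset_of_mem_nhds hev ⟨T, h⟩
    obtain ⟨r, hr, hrl⟩ := exists_between (lt_min hl h)
    obtain ⟨hrl, hrT⟩ := lt_min_iff.1 hrl
    exact (le_csSup hbdd ⟨hSτ.trans hr.le, hrT.le, hrightP τ r hSτ hr.le hrT.le
      (fun u hu => hlsub ⟨hu.1, hu.2.trans_lt hrl⟩) hPτ⟩).not_gt hr
  rw [hτT'] at hPτ
  obtain ⟨xs, h1, h2, -, h4⟩ := hPτ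
  exact ⟨xs, h1, h2, h4⟩

theorem exists_gauge_le_of_isContractionCoeff (hind : D.IndependentDirections)
    (hB : D.SetBCondition B) {α : ℝ} (hα : α ∈ D.U) :
    ∃ κ : ℝ≥0, ∀ κ', κ ≤ κ' → ∀ δ, D.IsContractionCoeff B {α} δ →
      ∀ h ψ φ η : ℝ≥0 → Euc J, Continuous h → (∀ t, h t ∈ D.G) → Continuous ψ →
        D.IsDPSolution α h ψ φ η → ∀ S T, S < T →
          gauge (B α) (φ T) ≤ δ ^ D.visitsAllFaces h S T * gauge (B α) (φ S) +
            κ' * sSup ((fun u => gauge (B α) (ψ u - ψ S)) '' Icc S T) := by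
  obtain ⟨θ, hθ⟩ := hB.exists_isMargin hα
  have hθ0 := hθ.1
  obtain ⟨hc, hconv, -, h0, -⟩ := hB.1 α hα
  have hadd := gauge_add_le hconv (absorbent_nhds_zero (mem_interior_iff_mem_nhds.1 h0))
  obtain ⟨R, hR, hRle⟩ := exists_norm_le_mul_gauge hc hconv h0
  -- The `1` pays for `ψ T - ψ S`, and `R / θ` for the distance to the product, with `R` converting
  -- gauge to Euclidean norm.
  refine ⟨⟨1 + R / θ, by positivity⟩, fun κ' hκ' δ hδ h ψ φ η hh hG hψ hdp S T hST => ?_⟩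
  have hgc := hB.continuous_gauge hα
  set M := sSup ((fun u => gauge (B α) (ψ u - ψ S)) '' Icc S T) with hM
  have hle : ∀ u ∈ Icc S T, gauge (B α) (ψ u - ψ S) ≤ M := fun u hu =>
    le_csSup ((isCompact_Icc.image (by fun_prop)).bddAbove) (mem_image_of_mem _ hu)
  have hT : T ∈ Icc S T := ⟨hST.le, le_rfl⟩
  have hM0 : 0 ≤ M := (gauge_nonneg _).trans (hle T hT)
  obtain ⟨xs, h1, h2, h3⟩ := hθ.exists_foldl_derivProj hind hB hα hh hG hψ hdp hST.le
    (C := R * M / θ) (by positivity) (fun u hu => by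
      rw [div_mul_cancel₀ _ hθ0.ne']
      exact (hRle _).trans (by gcongr; exact hle u hu))
  set y := xs.foldl (fun z x => D.derivProj α x z) (φ S) with hy
  have hyle : gauge (B α) y ≤ δ ^ D.visitsAllFaces h S T * gauge (B α) (φ S) := by
    rw [visitsAllFaces]
    split_ifs with hv
    · rw [pow_one]
      exact hδ.2.2 α rfl xs h1 (univ_subset_iff.1 (hv ▸ h2)) _
    · rw [pow_zero, one_mul]
      exact gauge_foldl_derivProj_le hind hB hα xs _
  have hκ : (1 + R / θ : ℝ) ≤ κ' := hκ'
  calc gauge (B α) (φ T) = gauge (B α) (y + ((ψ T - ψ S) + (φ T - (ψ T - ψ S) - y))) := by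
        congr 1; abel
    _ ≤ gauge (B α) y + (M + R * M / θ) :=
        (hadd _ _).trans (by
          gcongr
          exact (hadd _ _).trans (add_le_add (hle T hT) h3))
    _ = gauge (B α) y + (1 + R / θ) * M := by ring
    _ ≤ _ := by gcongr

end ReflectionData

/-! ### Uniformity over compact parameter sets and the contraction coefficient -/

namespace ReflectionData

variable {J : ℕ} {D : ReflectionData J} {B : ℝ → Set (Euc J)}

theorem SetBCondition.hausdorffEDist_ne_top (hB : D.SetBCondition B) {α β : ℝ} (hα : α ∈ D.U)
    (hβ : β ∈ D.U) : Metric.hausdorffEDist (B α) (B β) ≠ ⊤ :=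
  Metric.hausdorffEDist_ne_top_of_nonempty_of_bounded
    ⟨0, interior_subset (hB.1 α hα).2.2.2.1⟩ ⟨0, interior_subset (hB.1 β hβ).2.2.2.1⟩
    (hB.1 α hα).1.isBounded (hB.1 β hβ).1.isBounded

theorem SetBCondition.exists_uniform_bound (hB : D.SetBCondition B) {U₀ : Set ℝ}
    (hU₀ : IsCompact U₀) (hU : U₀ ⊆ D.U) : ∃ R : ℝ, 0 < R ∧ ∀ α ∈ U₀,
      (∀ y ∈ B α, ‖y‖ ≤ R) ∧ ∀ ν ∈ polarBody (B α), ‖ν‖ ≤ R := by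
  refine hU₀.induction_on
    (p := fun s => ∃ R : ℝ, 0 < R ∧ ∀ α ∈ s, (∀ y ∈ B α, ‖y‖ ≤ R) ∧ ∀ ν ∈ polarBody (B α), ‖ν‖ ≤ R)
    ⟨1, one_pos, fun _ h => h.elim⟩
    (fun s t hst ⟨R, hR, h⟩ => ⟨R, hR, fun α hα => h α (hst hα)⟩) ?_ ?_
  · rintro s t ⟨R, hR, h⟩ ⟨R', hR', h'⟩
    refine ⟨max R R', lt_max_of_lt_left hR, ?_⟩
    rintro α (hα | hα)
    · exact ⟨fun y hy => ((h α hα).1 y hy).trans (le_max_left _ _),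
        fun y hy => ((h α hα).2 y hy).trans (le_max_left _ _)⟩
    · exact ⟨fun y hy => ((h' α hα).1 y hy).trans (le_max_right _ _),
        fun y hy => ((h' α hα).2 y hy).trans (le_max_right _ _)⟩
  · intro a ha
    obtain ⟨hc, -, -, h0, -⟩ := hB.1 a (hU ha)
    obtain ⟨M, hM, hBM⟩ := hc.isBounded.exists_pos_norm_le
    obtain ⟨r, hr, hrB⟩ := Metric.mem_nhds_iff.1 (mem_interior_iff_mem_nhds.1 h0)
    have hev : ∀ᶠ α in 𝓝[U₀] a, Metric.hausdorffDist (B α) (B a) < r / 4 :=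
      ((hB.2 a (hU ha)).mono_left (nhdsWithin_mono _ hU)).eventually (gt_mem_nhds (by positivity))
    refine ⟨_, Filter.inter_mem hev self_mem_nhdsWithin, M + r / 4 + 4 / r, by positivity, ?_⟩
    rintro α ⟨hα, hαU⟩
    have hfin := hB.hausdorffEDist_ne_top (hU hαU) (hU ha)
    refine ⟨fun y hy => ?_, fun ν hν => ?_⟩
    · obtain ⟨y', hy', hyy'⟩ := Metric.exists_dist_lt_of_hausdorffDist_lt hy hα hfin
      have h1 : ‖y‖ ≤ ‖y'‖ + ‖y - y'‖ := by
        simpa [add_comm] using norm_add_le (y - y') y'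
      rw [dist_eq_norm] at hyy'
      have : 0 < 4 / r := by positivity
      linarith [hBM y' hy']
    · have hgoal : ‖ν‖ ≤ 4 / r := by
        rcases eq_or_ne ν 0 with rfl | hν0
        · simp only [norm_zero]; positivity
        have hνn : 0 < ‖ν‖ := norm_pos_iff.2 hν0
        -- A point of `B α` within `r / 4` of `y` gives `r / 2 * ‖ν‖ ≤ 1 + r / 4 * ‖ν‖`.
        set y := (r / 2 * ‖ν‖⁻¹) • ν with hy
        have hyB : y ∈ B a := hrB (by
          rw [mem_ball_zero_iff, hy, norm_smul, Real.norm_of_nonneg (by positivity), mul_assoc,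
            inv_mul_cancel₀ hνn.ne']
          linarith)
        obtain ⟨y', hy', hyy'⟩ := Metric.exists_dist_lt_of_hausdorffDist_lt' hyB hα hfin
        have e1 : inner ℝ ν y = r / 2 * ‖ν‖ := by
          rw [hy, real_inner_smul_right, real_inner_self_eq_norm_sq]
          field_simp
        have e2 : inner ℝ ν (y - y') ≤ ‖ν‖ * (r / 4) :=
          (real_inner_le_norm _ _).trans (by
            gcongr
            rw [← dist_eq_norm, dist_comm]
            exact hyy'.le)
        rw [inner_sub_right, e1] at e2
        rw [le_div_iff₀ hr]
        linarith [hν y' hy']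
      linarith

theorem SetBCondition.mem_of_tendsto (hB : D.SetBCondition B) {a : ℝ} (ha : a ∈ D.U)
    {α : ℕ → ℝ} (hα : ∀ n, α n ∈ D.U) (hlim : Tendsto α atTop (𝓝 a)) {y : ℕ → Euc J}
    (hy : ∀ n, y n ∈ B (α n)) {z : Euc J} (hz : Tendsto y atTop (𝓝 z)) : z ∈ B a := by
  obtain ⟨hc, -, -, h0, -⟩ := hB.1 a ha
  rw [hc.isClosed.mem_iff_infDist_zero ⟨0, interior_subset h0⟩]
  have hd := (hB.2 a ha).comp (tendsto_nhdsWithin_iff.2 ⟨hlim, Eventually.of_forall hα⟩)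
  have h1 : Tendsto (fun n => Metric.infDist (y n) (B a)) atTop (𝓝 0) :=
    squeeze_zero (fun n => Metric.infDist_nonneg) (fun n =>
      Metric.infDist_le_hausdorffDist_of_mem (hy n) (hB.hausdorffEDist_ne_top (hα n) ha)) hd
  exact tendsto_nhds_unique (((Metric.continuous_infDist_pt (B a)).tendsto z).comp hz) h1

theorem SetBCondition.mem_polarBody_of_tendsto (hB : D.SetBCondition B) {a : ℝ} (ha : a ∈ D.U)
    {α : ℕ → ℝ} (hα : ∀ n, α n ∈ D.U) (hlim : Tendsto α atTop (𝓝 a)) {y : ℕ → Euc J}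
    (hy : ∀ n, y n ∈ polarBody (B (α n))) {ν : Euc J} (hν : Tendsto y atTop (𝓝 ν)) :
    ν ∈ polarBody (B a) := by
  intro z hz
  have hd := (hB.2 a ha).comp (tendsto_nhdsWithin_iff.2 ⟨hlim, Eventually.of_forall hα⟩)
  have hex : ∀ n, ∃ w ∈ B (α n), Metric.infDist z (B (α n)) = dist z w := fun n =>
    (hB.1 _ (hα n)).1.exists_infDist_eq_dist ⟨0, interior_subset (hB.1 _ (hα n)).2.2.2.1⟩ z
  choose w hw hzw using hex
  have hwz : Tendsto w atTop (𝓝 z) := by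
    rw [tendsto_iff_dist_tendsto_zero]
    refine squeeze_zero (fun n => dist_nonneg) (fun n => ?_) hd
    rw [dist_comm, ← hzw, Function.comp_apply, Metric.hausdorffDist_comm]
    exact Metric.infDist_le_hausdorffDist_of_mem hz (hB.hausdorffEDist_ne_top ha (hα n))
  exact le_of_tendsto (hν.inner hwz) (Eventually.of_forall fun n => hy n _ (hw n))

/-- Almost normal functionals at points of the hyperplane with index `i` almost annihilate the `i`th
direction of reflection, uniformly over compact parameter sets. -/
theorem SetBCondition.exists_almost_normal (hB : D.SetBCondition B) {U₀ : Set ℝ}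
    (hU₀ : IsCompact U₀) (hU : U₀ ⊆ D.U) {ε : ℝ} (hε : 0 < ε) :
    ∃ δ : ℝ, 0 < δ ∧ ∀ α ∈ U₀, ∀ i, ∀ z, gauge (B α) z ≤ 1 → inner ℝ z (D.n i) = 0 →
      ∀ ν ∈ polarBody (B α), 1 - δ ≤ inner ℝ ν z → |inner ℝ ν (D.d i α)| ≤ ε := by
  suffices H : ∀ i, ∃ δ : ℝ, 0 < δ ∧ ∀ α ∈ U₀, ∀ z, gauge (B α) z ≤ 1 →
      inner ℝ z (D.n i) = 0 → ∀ ν ∈ polarBody (B α), 1 - δ ≤ inner ℝ ν z →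
        |inner ℝ ν (D.d i α)| ≤ ε by
    choose δ hδ h using H
    have hev : ∀ᶠ r in 𝓝[>] (0 : ℝ), ∀ i, r ≤ δ i :=
      eventually_all.2 fun i => nhdsWithin_le_nhds (ge_mem_nhds (hδ i))
    obtain ⟨r, hr, hr0⟩ := (hev.and self_mem_nhdsWithin).exists
    exact ⟨r, hr0, fun α hα i z hz hzn ν hν hνz =>
      h i α hα z hz hzn ν hν (by linarith [hr i])⟩
  intro i
  by_contra! hcon
  -- Counterexamples with `δ = 1 / (n + 1)` subconverge to an exact normal at a boundary point on
  -- the hyperplane, where the geometric condition forces the value zero.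
  choose α hα z hz hzn ν hν hνz hνd using fun n : ℕ => hcon (1 / ((n : ℝ) + 1)) (by positivity)
  obtain ⟨R, hR, hRb⟩ := hB.exists_uniform_bound hU₀ hU
  have hzB : ∀ n, z n ∈ B (α n) := fun n => by
    obtain ⟨hc, hconv, -, h0, -⟩ := hB.1 _ (hU (hα n))
    have := (gauge_le_one_iff_mem_closure hconv (mem_interior_iff_mem_nhds.1 h0)).1 (hz n)
    rwa [hc.isClosed.closure_eq] at this
  have hK : IsCompact (U₀ ×ˢ (Metric.closedBall (0 : Euc J) R ×ˢ Metric.closedBall (0 : Euc J) R)) :=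
    hU₀.prod ((isCompact_closedBall _ _).prod (isCompact_closedBall _ _))
  obtain ⟨⟨a, w, μ⟩, ⟨ha, -⟩, k, hk, hlim⟩ := hK.tendsto_subseq
    (x := fun n => (α n, z n, ν n)) fun n => ⟨hα n,
      mem_closedBall_zero_iff.2 ((hRb _ (hα n)).1 _ (hzB n)),
      mem_closedBall_zero_iff.2 ((hRb _ (hα n)).2 _ (hν n))⟩
  have haU : a ∈ D.U := hU ha
  have hlα : Tendsto (fun n => α (k n)) atTop (𝓝 a) := (continuous_fst.tendsto _).comp hlim
  have hlz : Tendsto (fun n => z (k n)) atTop (𝓝 w) :=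
    ((continuous_fst.comp continuous_snd).tendsto _).comp hlim
  have hlν : Tendsto (fun n => ν (k n)) atTop (𝓝 μ) :=
    ((continuous_snd.comp continuous_snd).tendsto _).comp hlim
  have hw : w ∈ B a := hB.mem_of_tendsto haU (fun n => hU (hα (k n))) hlα (fun n => hzB (k n)) hlz
  have hμ : μ ∈ polarBody (B a) :=
    hB.mem_polarBody_of_tendsto haU (fun n => hU (hα (k n))) hlα (fun n => hν (k n)) hlν
  have hwn : inner ℝ w (D.n i) = 0 :=
    tendsto_nhds_unique (hlz.inner tendsto_const_nhds)
      (tendsto_const_nhds.congr fun n => (hzn (k n)).symm)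
  have hμw : 1 ≤ inner ℝ μ w := by
    have h1 : Tendsto (fun n => 1 - 1 / ((k n : ℝ) + 1)) atTop (𝓝 (1 - 0)) :=
      tendsto_const_nhds.sub (tendsto_one_div_add_atTop_nhds_zero_nat.comp hk.tendsto_atTop)
    rw [sub_zero] at h1
    exact le_of_tendsto_of_tendsto' h1 (hlν.inner hlz) fun n => hνz (k n)
  have hμd : ε ≤ |inner ℝ μ (D.d i a)| := by
    have hd : Tendsto (fun n => D.d i (α (k n))) atTop (𝓝 (D.d i a)) :=
      ((D.contDiffOn_d i).continuousOn a haU).tendsto.comp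
        (tendsto_nhdsWithin_iff.2 ⟨hlα, Eventually.of_forall fun n => hU (hα (k n))⟩)
    exact ge_of_tendsto (hlν.inner hd).abs (Eventually.of_forall fun n => (hνd (k n)).le)
  obtain ⟨hc, hconv, -, h0, θ, hθ, hθB⟩ := hB.1 a haU
  have hg1 : gauge (B a) w = 1 := le_antisymm (gauge_le_one_of_mem hw)
    (hμw.trans (inner_le_gauge_of_mem_polarBody hc hconv h0 hμ w))
  have := inner_eq_zero_of_normal hconv h0 (hθB i) hμ
    (le_antisymm (inner_le_gauge_of_mem_polarBody hc hconv h0 hμ w) (hg1.trans_le hμw))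
    (hg1 ▸ one_pos) (by rw [hwn, abs_zero, hg1, one_mul]; exact hθ)
  rw [this, abs_zero] at hμd
  exact hμd.not_gt hε

theorem IndependentDirections.exists_mul_norm_le (hind : D.IndependentDirections) {U₀ : Set ℝ}
    (hU₀ : IsCompact U₀) (hU : U₀ ⊆ D.U) : ∃ c : ℝ, 0 < c ∧ ∀ α ∈ U₀, ∀ l : Fin J → ℝ,
      c * ‖l‖ ≤ ‖∑ i, l i • D.d i α‖ := by
  have hK : IsCompact (U₀ ×ˢ Metric.sphere (0 : Fin J → ℝ) 1) := hU₀.prod (isCompact_sphere _ _)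
  have hcont : ContinuousOn (fun p : ℝ × (Fin J → ℝ) => ‖∑ i, p.2 i • D.d i p.1‖)
      (U₀ ×ˢ Metric.sphere (0 : Fin J → ℝ) 1) := by
    refine (continuousOn_finsetSum _ fun i _ => ?_).norm
    refine ContinuousOn.smul (f := fun p : ℝ × (Fin J → ℝ) => p.2 i) (by fun_prop) ?_
    exact (D.contDiffOn_d i).continuousOn.comp continuousOn_fst fun p hp => hU hp.1
  obtain ⟨c, hc, hle⟩ := hK.exists_forall_le' hcont (a := 0) (by
    rintro ⟨α, l⟩ ⟨hα, hl⟩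
    refine norm_pos_iff.2 fun h0 => ?_
    have : l = 0 := funext (Fintype.linearIndependent_iff.1 (hind α (hU hα)) l h0)
    rw [this] at hl
    simp at hl)
  refine ⟨c, hc, fun α hα l => ?_⟩
  rcases eq_or_ne l 0 with rfl | hl
  · simp
  have hln : 0 < ‖l‖ := norm_pos_iff.2 hl
  have h1 := hle (α, ‖l‖⁻¹ • l) ⟨hα, by
    rw [mem_sphere_zero_iff_norm, norm_smul, norm_inv, norm_norm, inv_mul_cancel₀ hln.ne']⟩
  simp only [Pi.smul_apply, smul_eq_mul, mul_smul, ← Finset.smul_sum] at h1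
  rw [norm_smul, norm_inv, norm_norm, inv_mul_eq_div, le_div_iff₀ hln] at h1
  exact h1

/-- By uniform independence, the coefficients of `v` in the directions `d_i` are bounded by a
multiple of its gauge. -/
theorem SetBCondition.exists_abs_inner_le (hB : D.SetBCondition B)
    (hind : D.IndependentDirections) {U₀ : Set ℝ} (hU₀ : IsCompact U₀) (hU : U₀ ⊆ D.U) :
    ∃ K : ℝ, 0 < K ∧ ∀ α ∈ U₀, ∀ (A : Set (Fin J)) (ν v : Euc J) (ε : ℝ), 0 ≤ ε →
      (∀ i ∈ A, |inner ℝ ν (D.d i α)| ≤ ε) → v ∈ D.dirSpan α A →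
      |inner ℝ ν v| ≤ K * ε * gauge (B α) v := by
  obtain ⟨c, hc, hcle⟩ := hind.exists_mul_norm_le hU₀ hU
  obtain ⟨R, hR, hRb⟩ := hB.exists_uniform_bound hU₀ hU
  refine ⟨(J + 1) * (R / c), by positivity, fun α hα A ν v ε hε hν hv => ?_⟩
  obtain ⟨l, hl, rfl⟩ := (Finsupp.mem_span_image_iff_linearCombination ℝ).1 hv
  rw [Finsupp.linearCombination_apply, Finsupp.sum_fintype _ _ (by simp)]
  have hnorm : ‖∑ i, l i • D.d i α‖ ≤ R * gauge (B α) (∑ i, l i • D.d i α) := by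
    obtain ⟨hcp, hconv, -, h0, -⟩ := hB.1 α (hU hα)
    obtain ⟨hg, b, hb, hu⟩ := (isLeast_gauge hcp hconv h0 (∑ i, l i • D.d i α)).1
    calc ‖∑ i, l i • D.d i α‖ = gauge (B α) (∑ i, l i • D.d i α) * ‖b‖ := by
          conv_lhs => rw [← hu]
          change ‖gauge (B α) (∑ i, l i • D.d i α) • b‖ = _
          rw [norm_smul, Real.norm_of_nonneg hg]
      _ ≤ gauge (B α) (∑ i, l i • D.d i α) * R := by gcongr; exact (hRb α hα).1 b hb
      _ = _ := mul_comm _ _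
  have hcoef : ‖(l : Fin J → ℝ)‖ ≤ R / c * gauge (B α) (∑ i, l i • D.d i α) := by
    rw [div_mul_eq_mul_div, le_div_iff₀ hc, mul_comm]
    exact (hcle α hα l).trans hnorm
  have hterm : ∀ i, |inner ℝ ν (l i • D.d i α)| ≤ ‖(l : Fin J → ℝ)‖ * ε := by
    intro i
    rw [real_inner_smul_right, abs_mul]
    by_cases hi : i ∈ A
    · exact mul_le_mul (norm_le_pi_norm (l : Fin J → ℝ) i) (hν i hi) (abs_nonneg _)
        (norm_nonneg _)
    · have : l i = 0 := by
        by_contra h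
        exact hi ((Finsupp.mem_supported ℝ l).1 hl (by simpa using h))
      rw [this, abs_zero, zero_mul]
      positivity
  calc |inner ℝ ν (∑ i, l i • D.d i α)| ≤ ∑ i, |inner ℝ ν (l i • D.d i α)| := by
        rw [inner_sum]; exact Finset.abs_sum_le_sum_abs _ _
    _ ≤ ∑ _i : Fin J, ‖(l : Fin J → ℝ)‖ * ε := Finset.sum_le_sum fun i _ => hterm i
    _ = J * (‖(l : Fin J → ℝ)‖ * ε) := by simp
    _ ≤ (J + 1) * (R / c * gauge (B α) (∑ i, l i • D.d i α) * ε) := by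
        gcongr
        linarith
    _ = _ := by ring

/-- Take the shortest suffix that still covers all the faces; `x` is its head. -/
theorem exists_split_last_new (xs : List (Euc J)) (hne : (⋃ x ∈ xs, D.activeSet x).Nonempty) :
    ∃ (r : List (Euc J)) (x : Euc J) (b : List (Euc J)), xs = r ++ x :: b ∧
      (⋃ y ∈ b, D.activeSet y) ⊂ (⋃ y ∈ xs, D.activeSet y) ∧
      (⋃ y ∈ xs, D.activeSet y) = D.activeSet x ∪ ⋃ y ∈ b, D.activeSet y := by
  induction xs with
  | nil => simp at hne
  | cons x t ih =>
    have hcons : (⋃ y ∈ x :: t, D.activeSet y) = D.activeSet x ∪ ⋃ y ∈ t, D.activeSet y := by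
      ext i; simp
    by_cases h : (⋃ y ∈ t, D.activeSet y) = ⋃ y ∈ x :: t, D.activeSet y
    · obtain ⟨r, z, b, h1, h2, h3⟩ := ih (h ▸ hne)
      exact ⟨x :: r, z, b, by rw [h1, List.cons_append], h ▸ h2, h ▸ h3⟩
    · exact ⟨[], x, t, rfl, lt_of_le_of_ne (hcons ▸ subset_union_right) h, hcons⟩

/-- Functionals almost attaining the norm after a product of derivative projections almost annihilate
all directions of reflection used in it, uniformly in the length of the product. -/
theorem eventually_almost_normal (hind : D.IndependentDirections) (hB : D.SetBCondition B)
    {U₀ : Set ℝ} (hU₀ : IsCompact U₀) (hU : U₀ ⊆ D.U) (A : Set (Fin J)) :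
    ∀ ε > 0, ∀ᶠ δ in 𝓝[>] (0 : ℝ), ∀ α ∈ U₀, ∀ xs : List (Euc J),
      (⋃ x ∈ xs, D.activeSet x) = A → ∀ y, gauge (B α) y ≤ 1 → ∀ ν ∈ polarBody (B α),
        1 - δ ≤ inner ℝ ν (xs.foldl (fun z x => D.derivProj α x z) y) →
          ∀ i ∈ A, |inner ℝ ν (D.d i α)| ≤ ε := by
  induction A using WellFoundedLT.induction with
  | ind A ih =>
  intro ε hε
  obtain ⟨K, hK, hKle⟩ := hB.exists_abs_inner_le hind hU₀ hU
  obtain ⟨δ₀, hδ₀, hbase⟩ := hB.exists_almost_normal hU₀ hU hε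
  -- The tail `b` displaces `z` by gauge at most `2`, changing the value of `ν` by at most `2 * K *
  -- ε₁ ≤ δ₀ / 2`. With `δ ≤ δ₀ / 2` this leaves `ν` within the tolerance `δ₀` at `z`, which lies in
  -- the hyperplanes active at `x`.
  set ε₁ := min ε (δ₀ / (4 * K)) with hε₁
  have hε₁0 : 0 < ε₁ := lt_min hε (by positivity)
  have hKε : K * ε₁ ≤ δ₀ / 4 := by
    calc K * ε₁ ≤ K * (δ₀ / (4 * K)) := by gcongr; exact min_le_right _ _
      _ = δ₀ / 4 := by field_simp
  have hall := eventually_all.2 fun A' : Set (Fin J) => eventually_imp_distrib_left.2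
    fun hA' : A' < A => ih A' hA' ε₁ hε₁0
  have hsmall : ∀ᶠ δ in 𝓝[>] (0 : ℝ), δ ≤ δ₀ / 2 :=
    nhdsWithin_le_nhds (ge_mem_nhds (by positivity))
  filter_upwards [hall, hsmall] with δ hδ hδ' α hα xs hxs y hy ν hν hνy i hi
  obtain ⟨r, x, b, hsplit, hb, hun⟩ := exists_split_last_new (D := D) xs (hxs ▸ ⟨i, hi⟩)
  rw [hsplit, List.foldl_append, List.foldl_cons] at hνy
  set z := D.derivProj α x (r.foldl (fun z x => D.derivProj α x z) y) with hz
  have hz1 : gauge (B α) z ≤ 1 := (gauge_derivProj_le hind hB (hU hα) _ _).trans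
    ((gauge_foldl_derivProj_le hind hB (hU hα) _ _).trans hy)
  have hbd := hδ _ (hxs ▸ hb) α hα b rfl z hz1 ν hν hνy
  rw [← hxs, hun] at hi
  rcases hi with hi | hi
  · refine hbase α hα i z hz1 ((derivProj_spec hind hB (hU hα) _ _).1 i hi) ν hν ?_
    have h1 := hKle α hα _ ν _ ε₁ hε₁0.le hbd (foldl_derivProj_sub_mem hind hB (hU hα) b z)
    obtain ⟨-, hconv, hsymm, h0, -⟩ := hB.1 α (hU hα)
    have h2 : gauge (B α) (b.foldl (fun z x => D.derivProj α x z) z - z) ≤ 2 := by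
      rw [sub_eq_add_neg]
      refine (gauge_add_le hconv (absorbent_nhds_zero (mem_interior_iff_mem_nhds.1 h0)) _ _).trans ?_
      rw [gauge_neg hsymm]
      linarith [gauge_foldl_derivProj_le hind hB (hU hα) b z]
    have h3 : |inner ℝ ν (b.foldl (fun z x => D.derivProj α x z) z - z)| ≤ δ₀ / 4 * 2 :=
      h1.trans (mul_le_mul hKε h2 (gauge_nonneg _) (by positivity))
    rw [inner_sub_right] at h3
    linarith [(abs_le.1 h3).2]
  · exact (hbd i hi).trans (min_le_left _ _)

theorem exists_isContractionCoeff (hind : D.IndependentDirections) (hB : D.SetBCondition B)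
    {U₀ : Set ℝ} (hU₀ : IsCompact U₀) (hU : U₀ ⊆ D.U) : ∃ δ, D.IsContractionCoeff B U₀ δ := by
  obtain ⟨K, hK, hKle⟩ := hB.exists_abs_inner_le hind hU₀ hU
  have hsmall : ∀ᶠ δ in 𝓝[>] (0 : ℝ), δ < 1 / 2 := nhdsWithin_le_nhds (gt_mem_nhds (by positivity))
  -- The tolerance `1 / (2 * K)` makes a norming functional of the output `p` satisfy `gauge p ≤
  -- gauge p / 2`, impossible if `gauge p > 1 - δ > 1 / 2`.
  obtain ⟨δ, ⟨hδ, hδ2⟩, hδ0⟩ := (((eventually_almost_normal hind hB hU₀ hU univ (1 / (2 * K))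
    (by positivity)).and hsmall).and self_mem_nhdsWithin).exists
  replace hδ0 : 0 < δ := hδ0
  refine ⟨1 - δ, by linarith, by linarith, fun α hα xs _ hxs y => ?_⟩
  obtain ⟨hc, hconv, -, h0, -⟩ := hB.1 α (hU hα)
  have hone : ∀ y, gauge (B α) y ≤ 1 →
      gauge (B α) (xs.foldl (fun z x => D.derivProj α x z) y) ≤ 1 - δ := by
    intro y hy
    by_contra! hlt
    set p := xs.foldl (fun z x => D.derivProj α x z) y with hp
    obtain ⟨ν, hν, hνp⟩ := exists_mem_polarBody_inner_eq_gauge hc hconv h0 p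
    have hd := hδ α hα xs hxs y hy ν hν (by rw [hνp]; exact hlt.le)
    have htop : p ∈ D.dirSpan α univ := by
      rw [dirSpan, image_univ,
        (hind α (hU hα)).span_eq_top_of_card_eq_finrank' (by simp)]
      trivial
    have h1 := hKle α hα univ ν p _ (by positivity) hd htop
    have h2 : K * (1 / (2 * K)) = 1 / 2 := by field_simp
    rw [h2, hνp, abs_of_nonneg (gauge_nonneg _)] at h1
    linarith
  rcases eq_or_ne y 0 with rfl | hy
  · have := gauge_foldl_derivProj_le hind hB (hU hα) xs 0
    simpa using this
  have hpos := gauge_pos_of_ne_zero hc h0 hy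
  have h1 := hone ((gauge (B α) y)⁻¹ • y) (by
    rw [gauge_smul_of_nonneg (inv_nonneg.2 hpos.le), smul_eq_mul, inv_mul_cancel₀ hpos.ne'])
  rw [foldl_derivProj_smul hind hB (hU hα), gauge_smul_of_nonneg (inv_nonneg.2 hpos.le),
    smul_eq_mul, inv_mul_le_iff₀ hpos] at h1
  linarith

end ReflectionData

/-! ### The proposition -/

theorem mainTheorem6 {J : ℕ} (D : ReflectionData J) (B : ℝ → Set (Euc J))
    (hind : D.IndependentDirections) (hB : D.SetBCondition B) (hproj : D.ProjectionCondition) :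
    ∃ κ : ℝ → ℝ≥0, (∀ α ∈ D.U, D.IsDerivLipschitzConst α (κ α)) ∧
      ∀ U₀ : Set ℝ, IsCompact U₀ → U₀ ⊆ D.U →
        (∃ δ₀ : ℝ, D.IsContractionCoeff B U₀ δ₀) ∧
        ∀ δ₀ : ℝ, D.IsContractionCoeff B U₀ δ₀ →
          ∀ α ∈ U₀, ∀ f h g ψ φ η : ℝ≥0 → Euc J,
            Continuous f → f 0 ∈ D.G → Continuous ψ →
            D.IsSPSolution α f h g → D.IsDPSolution α h ψ φ η →
            ∀ S T : ℝ≥0, S < T →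
              gauge (B α) (φ T) ≤ δ₀ ^ D.visitsAllFaces h S T * gauge (B α) (φ S) +
                κ α * sSup ((fun u => gauge (B α) (ψ u - ψ S)) '' Icc S T) := by
  classical
  choose! κ₁ hκ₁ using fun α (hα : α ∈ D.U) =>
    ReflectionData.exists_derivLipschitzConst hB hα
  choose! κ₂ hκ₂ using fun α (hα : α ∈ D.U) =>
    ReflectionData.exists_gauge_le_of_isContractionCoeff hind hB hα
  refine ⟨fun α => max (κ₁ α) (κ₂ α), fun α hα => hκ₁ α hα _ (le_max_left _ _),
    fun U₀ hU₀ hU => ⟨ReflectionData.exists_isContractionCoeff hind hB hU₀ hU, ?_⟩⟩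
  intro δ₀ hδ₀ α hα f h g ψ φ η _ _ hψ hsp hdp S T hST
  -- A coefficient for `U₀` is one for `{α}`, so the constant depends on `α` alone.
  refine hκ₂ α (hU hα) _ (le_max_right _ _) δ₀ ⟨hδ₀.1, hδ₀.2.1, ?_⟩ h ψ φ η hsp.continuous_h
    hsp.mem_G hψ hdp S T hST
  rintro _ rfl
  exact hδ₀.2.2 _ hα
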